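/- Let $K$ be a number field, let $p_1,p_2,\dots$ be a sequence of rational primes (repetitions allowed) and, for every $i$, let $v_i$ be a prime of $K$ above $p_i$; put $\mathcal T_m=\{v_1,\dots,v_m\}$. Fix an algebraic closure $\overline K$ of $K$; all extensions of $K$ below are subfields of it. Write $K_v$ for the completion of $K$ at $v$. For a finite group $\Gamma$, a finite set $\mathcal T$ of primes of $K$ and groups $\Gamma_v$ $(v\in\mathcal T)$ embeddable in $\Gamma$, a *solution of the Grunwald problem* for $(\Gamma,\mathcal T,\{\Gamma_v\}_{v\in\mathcal T})$ is a finite Galois extension $M/K$ with $\mathrm{Gal}(M/K)\cong\Gamma$ such that for every $v\in\mathcal T$ there is a finite Galois extension $E_v/K_v$ with $\mathrm{Gal}(E_v/K_v)\cong\Gamma_v$ to which the completions of $M$ at all primes above $v$ are isomorphic over $K_v$. For an extension $L/K$ in $\overline K$ and a positive integer $B$, say that *the local degrees of $L$ at $p_i$ (above $v_i$) are bounded by $B$* if there are an extension $E/\mathbb Q_{p_i}$ of degree at most $B$ and a field embedding $\sigma:L\to E$ which induces the prime $v_i$ on $K$, i.e. $v_i=\{x\in\mathcal O_K: |\sigma(x)|<1\}$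 for the extension $|\cdot|$ of the $p_i$-adic absolute value to $E$; they are *unbounded* if this holds for no $B$. **Theorem.** Let $(G_m)_{m\ge1}$ be finite groups with unbounded exponents and let $G=\prod_{m\ge1}G_m$ be their direct product, with the product topology. Suppose that for every choice of cyclic groups $G_{m,v}$ embeddable in $G_m$ ($m\ge 1$, $v\in\mathcal T_m$) there is a family $(L_m)_{m\ge1}$ of Galois extensions of $K$ such that, for every $m$, $L_m$ is a solution of the Grunwald problem for $(G_m,\mathcal T_m,\{G_{m,v}\}_{v\in\mathcal T_m})$ and $L_m$ is linearly disjoint over $K$ from the compositum of $L_1,\dots,L_{m-1}$. Then there are two Galois extensions $L$ and $L'$ of $K$, both with Galois group isomorphic to $G$ (as topological groups), such that for every $i\ge1$ the local degrees of $L$ at $p_i$ are bounded by $[K:\mathbb Q]\prod_{j=1}^{i-1}|G_j|$ (that is, by $[K:\mathbb Q]$ if $i=1$), and the local degrees of $L'$ at $p_i$ are unbounded. -/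

import Mathlib

open scoped NumberField
open IsDedekindDomain

/-- `ι` is the canonical embedding `K_v → L_w` of completions: the (unique) continuous ring
homomorphism which extends the inclusion `K → L`. -/
def IsCompletionMap {K L : Type*} [Field K] [NumberField K] [Field L] [NumberField L]
    [Algebra K L] (v : HeightOneSpectrum (𝓞 K)) (w : HeightOneSpectrum (𝓞 L))
    (ι : v.adicCompletion K →+* w.adicCompletion L) : Prop :=
  Continuous ι ∧
    ∀ x : K, ι (algebraMap K (v.adicCompletion K) x) =
      algebraMap L (w.adicCompletion L) (algebraMap K L x)

/-- The completion `L_w` is isomorphic to `E` as an extension of `K_v`, where `L_w` is regarded as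
an extension of `K_v` through the canonical embedding `K_v → L_w`. -/
def CompletionIso {K L : Type*} [Field K] [NumberField K] [Field L] [NumberField L]
    [Algebra K L] (v : HeightOneSpectrum (𝓞 K)) (w : HeightOneSpectrum (𝓞 L))
    (E : Type*) [Field E] [Algebra (v.adicCompletion K) E] : Prop :=
  ∃ φ : E ≃+* w.adicCompletion L,
    IsCompletionMap v w (φ.toRingHom.comp (algebraMap (v.adicCompletion K) E))

/-- Every completion of `L` at a prime above `v` is isomorphic, over `K_v`, to one and the same
finite Galois extension `E` of `K_v`, whose Galois group is isomorphic to `C`. -/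
def HasLocalGroup {K : Type*} {L : Type*} [Field K] [NumberField K] [Field L] [NumberField L]
    [Algebra K L] (v : HeightOneSpectrum (𝓞 K)) (C : Type*) [Group C] : Prop :=
  ∃ E : IntermediateField (v.adicCompletion K) (AlgebraicClosure (v.adicCompletion K)),
    FiniteDimensional (v.adicCompletion K) E ∧
    IsGalois (v.adicCompletion K) E ∧
    Nonempty (Gal(E/(v.adicCompletion K)) ≃* C) ∧
    ∀ w : HeightOneSpectrum (𝓞 L), w.asIdeal.LiesOver v.asIdeal → CompletionIso v w E

/-- `L / K` is a realisation of the topological group `H`: it is a Galois extension, and its Galois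
group, with the Krull topology, is isomorphic to `H` as a topological group. -/
def IsRealisation {K : Type*} [Field K] (H : Type*) [Group H] [TopologicalSpace H]
    (L : IntermediateField K (AlgebraicClosure K)) : Prop :=
  IsGalois K L ∧ Nonempty (Gal(L/K) ≃ₜ* H)

/-- `L / K` is a solution of the Grunwald problem for `(G, T, C)`: a finite Galois extension of
group `G` whose completions at the primes above `v` are Galois over `K_v` with group `C v`, for
every `v` in `T`. (Groups embeddable in `G` are given as subgroups of `G`.) -/
def IsGrunwaldSolution {K : Type*} [Field K] [NumberField K] {G : Type*} [Group G]
    (T : Set (HeightOneSpectrum (𝓞 K))) (C : T → Subgroup G)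
    (L : IntermediateField K (AlgebraicClosure K)) : Prop :=
  ∃ _ : FiniteDimensional K L,
    haveI : NumberField L := NumberField.of_module_finite K L
    IsGalois K L ∧ Nonempty (Gal(L/K) ≃* G) ∧
      ∀ v : T, HasLocalGroup (K := K) (L := L) v.1 (C v)

/-- Local degrees at the rational prime `p`, measured above the prime `v` of `K` over `p`: the
extension `L` of `K` embeds in an extension `E` of `ℚ_p` of degree at most `B`, in such a way that
the prime of `K` induced by the embedding is `v`. The absolute value on `E` is the spectral norm,
which is the unique extension of the `p`-adic absolute value. -/
def LocalDegreeLE {K L : Type*} [Field K] [NumberField K] [Field L] [Algebra K L]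
    (p : ℕ) [Fact p.Prime] (v : HeightOneSpectrum (𝓞 K)) (B : ℕ) : Prop :=
  ∃ (E : Type) (_ : Field E) (_ : Algebra ℚ_[p] E) (σ : L →+* E),
    FiniteDimensional ℚ_[p] E ∧ Module.finrank ℚ_[p] E ≤ B ∧
    ∀ x : 𝓞 K, x ∈ v.asIdeal ↔ spectralNorm ℚ_[p] E (σ (algebraMap K L x)) < 1

/-! Both fields are composita of a family `L m` supplied by the hypothesis; only the prescribed
cyclic local groups differ. By linear disjointness, finitely many automorphisms of the `L m` always
lift simultaneously, so the Galois group of the compositum is dense in the product, and by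
compactness equal to it (`nonempty_galEquiv_pi_of_linearDisjoint`). For bounded degrees take all
local groups trivial. Then `L m` embeds in the completion at `v i` for every `m ≥ i`, so over that
completion, of degree at most `[K : ℚ]` over `ℚ_p`, only the fields `L j` with `j < i` contribute
(`localDegreeLE_iSup`). For unbounded degrees take local groups generated by elements of maximal
order. Unbounded exponents force unbounded orders, and a local degree is at least the order of the
local group (`HasLocalGroup.card_le_of_localDegreeLE`). -/

/-! ### Completions of number fields as finite extensions of `ℚ_p`. -/

open Filter Topology in
theorem WithVal.continuous_of_bounded {F Γ₀ A : Type*} [Field F]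
    [LinearOrderedCommGroupWithZero Γ₀] (ν : Valuation F Γ₀) [Ring A] [TopologicalSpace A]
    [IsTopologicalRing A] (f : WithVal ν →+* A) (π : WithVal ν) (hπ : π ≠ 0) (S : Set A)
    (hS : ∀ U ∈ 𝓝 (0 : A), ∃ n : ℕ, ∀ s ∈ S, f π ^ n * s ∈ U)
    (hf : ∀ x : WithVal ν, ν x.ofVal ≤ 1 → f x ∈ S) : Continuous f := by
  refine continuous_of_continuousAt_zero f.toAddMonoidHom ?_
  intro U hU
  simp only [RingHom.toAddMonoidHom_eq_coe, map_zero] at hU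
  obtain ⟨n, hn⟩ := hS U hU
  have hn0 : π ^ n ≠ 0 := pow_ne_zero _ hπ
  rw [mem_map, Valued.mem_nhds_zero]
  refine ⟨Units.mk0 (Valued.v.restrict (π ^ n)) ?_, ?_⟩
  · simp [Valuation.restrict_def, hπ]
  · intro x hx
    simp only [Units.val_mk0, Set.mem_ofPred_eq, Valuation.restrict_lt_iff] at hx
    -- Each point of the ball is `π ^ n` times an integral element, so its image lies in `f π ^ n *
    -- S`, which is small.
    have h1 : f x = f π ^ n * f (x / π ^ n) := by
      rw [← map_pow, ← map_mul, mul_div_cancel₀ _ hn0]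
    change f x ∈ U
    rw [h1]
    apply hn
    apply hf
    change (Valued.v (x / π ^ n) : Γ₀) ≤ 1
    rw [map_div₀]
    exact div_le_one_of_le₀ hx.le zero_le

namespace IsDedekindDomain.HeightOneSpectrum

variable {K : Type*} [Field K] [NumberField K]

theorem valued_algebraMap (v : HeightOneSpectrum (𝓞 K)) (x : K) :
    Valued.v (algebraMap K (v.adicCompletion K) x) = v.valuation K x :=
  adicCompletion.valued_coe K v x

open Filter Topology in
theorem tendsto_pow_zero_of_valued_lt_one (v : HeightOneSpectrum (𝓞 K)) {x : v.adicCompletion K}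
    (hx : Valued.v x < 1) {U : Set (v.adicCompletion K)} (hU : U ∈ 𝓝 0) :
    ∃ n : ℕ, ∀ m ≥ n, ∀ s, Valued.v s ≤ 1 → x ^ m * s ∈ U := by
  obtain ⟨γ, hγ⟩ := Valued.mem_nhds_zero.1 hU
  obtain ⟨n, hn⟩ := exists_pow_lt₀ hx
    (Units.mk0 _ (MonoidWithZeroHom.ValueGroup₀.embedding_unit_ne_zero γ))
  refine ⟨n, fun m hm s hs => hγ ?_⟩
  rw [Set.mem_ofPred_eq, Valuation.restrict_lt_iff_lt_embedding]
  rw [Units.val_mk0] at hn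
  refine lt_of_le_of_lt ?_ hn
  rw [map_mul, map_pow]
  calc _ ≤ Valued.v x ^ m * 1 := mul_le_mul_right hs _
    _ ≤ _ := by rw [mul_one]; exact pow_le_pow_right_of_le_one' hx.le hm

variable {p : ℕ} [Fact p.Prime]

theorem valuation_ratCast_le_one (v : HeightOneSpectrum (𝓞 K)) (hp : (p : 𝓞 K) ∈ v.asIdeal)
    {q : ℚ} (hq : Rat.padicValuation p q ≤ 1) : v.valuation K (q : K) ≤ 1 := by
  rw [Rat.padicValuation_le_one_iff] at hq
  have hden : (q.den : 𝓞 K) ∉ v.asIdeal := by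
    intro h
    have hc : IsCoprime (p : ℤ) (q.den : ℤ) :=
      Nat.isCoprime_iff_coprime.2 ((Nat.Prime.coprime_iff_not_dvd Fact.out).2 hq)
    obtain ⟨a, b, hab⟩ := hc
    have := congrArg (Int.cast : ℤ → 𝓞 K) hab
    push_cast at this
    apply v.isPrime.ne_top
    rw [Ideal.eq_top_iff_one, ← this]
    exact add_mem (Ideal.mul_mem_left _ _ hp) (Ideal.mul_mem_left _ _ h)
  have h1 : v.valuation K ((q.den : 𝓞 K) : K) = 1 := v.valuation_eq_one_iff_notMem.2 hden
  have h2 : v.valuation K ((q.num : 𝓞 K) : K) ≤ 1 := v.valuation_le_one _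
  rw [Rat.cast_def, map_div₀]
  simp only [map_natCast, map_intCast] at h1 h2
  rw [h1, div_one]
  exact h2

/-- `ℚ_p` is the completion of `ℚ`, so it suffices that `ℚ → K_v` is continuous for the `p`-adic
valuation. -/
theorem exists_continuous_padic_hom (v : HeightOneSpectrum (𝓞 K)) (hp : (p : 𝓞 K) ∈ v.asIdeal) :
    ∃ f : ℚ_[p] →+* v.adicCompletion K, Continuous f := by
  let g : WithVal (Rat.padicValuation p) →+* v.adicCompletion K :=
    (algebraMap K (v.adicCompletion K)).comp
      ((algebraMap ℚ K).comp (WithVal.equiv (Rat.padicValuation p)).toRingHom)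
  have hg : Continuous g := by
    refine WithVal.continuous_of_bounded _ g p ?_ {x | Valued.v x ≤ 1} ?_ ?_
    · exact_mod_cast (Fact.out : p.Prime).ne_zero
    · intro U hU
      have : Valued.v (p : v.adicCompletion K) < 1 := by
        have h := v.valued_algebraMap (p : K)
        rw [map_natCast] at h
        rw [h]
        have := (v.valuation_lt_one_iff_mem (K := K) (p : 𝓞 K)).2 hp
        simpa using this
      obtain ⟨n, hn⟩ := v.tendsto_pow_zero_of_valued_lt_one this hU
      refine ⟨n, fun s hs => ?_⟩
      rw [map_natCast]
      exact hn n le_rfl s hs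
    · intro x hx
      exact (v.valued_algebraMap _).trans_le (v.valuation_ratCast_le_one hp hx)
  refine ⟨(UniformSpace.Completion.extensionHom g hg).comp
    (Padic.withValRingEquiv (p := p)).symm.toRingHom, ?_⟩
  exact UniformSpace.Completion.continuous_extension.comp
    (Padic.withValUniformEquiv (p := p)).symm.continuous

/-- The `ℚ_p`-span of a `ℚ`-basis of `K` is finite-dimensional, hence closed, and contains the dense
subfield `K`; so it is all of `K_v`. -/
theorem finite_of_continuous_algebraMap (v : HeightOneSpectrum (𝓞 K))
    [Algebra ℚ_[p] (v.adicCompletion K)]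
    (hf : Continuous (algebraMap ℚ_[p] (v.adicCompletion K))) :
    Module.Finite ℚ_[p] (v.adicCompletion K) ∧
      Module.finrank ℚ_[p] (v.adicCompletion K) ≤ Module.finrank ℚ K := by
  have : ContinuousSMul ℚ_[p] (v.adicCompletion K) := by
    refine ⟨?_⟩
    simp only [Algebra.smul_def]
    exact (hf.comp continuous_fst).mul continuous_snd
  let b := Module.finBasis ℚ K
  let c : Fin (Module.finrank ℚ K) → v.adicCompletion K := fun i => algebraMap K _ (b i)
  have hfin : FiniteDimensional ℚ_[p] (Submodule.span ℚ_[p] (Set.range c)) :=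
    FiniteDimensional.span_of_finite _ (Set.finite_range c)
  have hcl : IsClosed (Submodule.span ℚ_[p] (Set.range c) : Set (v.adicCompletion K)) :=
    Submodule.closed_of_finiteDimensional _
  have hK : Set.range (algebraMap K (v.adicCompletion K)) ⊆
      (Submodule.span ℚ_[p] (Set.range c) : Set (v.adicCompletion K)) := by
    rintro _ ⟨x, rfl⟩
    rw [← b.sum_repr x, map_sum]
    refine Submodule.sum_mem _ fun i _ => ?_
    have : algebraMap K (v.adicCompletion K) (b.repr x i • b i) =
        ((b.repr x i : ℚ) : ℚ_[p]) • c i := by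
      rw [Algebra.smul_def, Algebra.smul_def, map_mul, map_ratCast]
      simp [c]
    rw [this]
    exact Submodule.smul_mem _ _ (Submodule.subset_span ⟨i, rfl⟩)
  have htop : Submodule.span ℚ_[p] (Set.range c) = ⊤ := by
    rw [← SetLike.coe_set_eq, ← hcl.closure_eq]
    exact ((denseRange_algebraMap K v).mono hK).closure_eq
  refine ⟨?_, ?_⟩
  · rw [htop] at hfin
    exact Module.finite_def.2 (Module.Finite.iff_fg.1 hfin)
  · have := finrank_range_le_card (R := ℚ_[p]) c
    rw [Set.finrank, htop, finrank_top, Fintype.card_fin] at this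
    exact this

end IsDedekindDomain.HeightOneSpectrum

/-! ### Spectral norms and the primes they induce. -/

section SpectralNorm

variable {p : ℕ} [Fact p.Prime] {E : Type*} [Field E] [Algebra ℚ_[p] E]

/-- The image of an algebraic integer is integral over `ℤ_p`, so its minimal polynomial over `ℚ_p`
has coefficients of norm at most 1. -/
theorem spectralNorm_ringOfIntegers_le_one {K : Type*} [Field K] (σ : 𝓞 K →+* E) (y : 𝓞 K) :
    spectralNorm ℚ_[p] E (σ y) ≤ 1 := by
  let : Algebra ℤ_[p] E := ((algebraMap ℚ_[p] E).comp (algebraMap ℤ_[p] ℚ_[p])).toAlgebra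
  have : IsScalarTower ℤ_[p] ℚ_[p] E := .of_algebraMap_eq fun _ => rfl
  have hx : IsIntegral ℤ_[p] (σ y) :=
    (NumberField.RingOfIntegers.isIntegral y).map_of_comp_eq (Int.castRingHom ℤ_[p]) σ (Subsingleton.elim _ _)
  rw [spectralNorm, minpoly.isIntegrallyClosed_eq_field_fractions' ℚ_[p] hx,
    spectralValue_le_one_iff ((minpoly.monic hx).map _)]
  intro n
  rw [Polynomial.coeff_map]
  exact PadicInt.norm_le_one _

end SpectralNorm

namespace IsDedekindDomain.HeightOneSpectrum

variable {K : Type*} [Field K] [NumberField K] {p : ℕ} [Fact p.Prime]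

open Filter Topology in
theorem mem_asIdeal_iff_spectralNorm_lt_one (v : HeightOneSpectrum (𝓞 K))
    [Algebra ℚ_[p] (v.adicCompletion K)]
    (hf : Continuous (algebraMap ℚ_[p] (v.adicCompletion K)))
    {E : Type*} [Field E] [Algebra ℚ_[p] E] [FiniteDimensional ℚ_[p] E]
    (g : v.adicCompletion K →ₐ[ℚ_[p]] E) (x : 𝓞 K) :
    x ∈ v.asIdeal ↔ spectralNorm ℚ_[p] E (g (algebraMap K _ (x : K))) < 1 := by
  have hle (y : 𝓞 K) : spectralNorm ℚ_[p] E (g (algebraMap K _ (y : K))) ≤ 1 := by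
    exact spectralNorm_ringOfIntegers_le_one ((g : v.adicCompletion K →+* E).comp
      ((algebraMap K _).comp (algebraMap (𝓞 K) K))) y
  have : ContinuousSMul ℚ_[p] (v.adicCompletion K) := by
    refine ⟨?_⟩
    simp only [Algebra.smul_def]
    exact (hf.comp continuous_fst).mul continuous_snd
  have := (v.finite_of_continuous_algebraMap hf).1
  let := spectralNorm.normedField ℚ_[p] E
  let := spectralNorm.normedAlgebra ℚ_[p] E
  have hg : Continuous g := LinearMap.continuous_of_finiteDimensional g.toLinearMap
  have hlt {y : 𝓞 K} (hy : y ∈ v.asIdeal) : ‖g (algebraMap K _ (y : K))‖ < 1 := by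
    have h1 : Tendsto (fun n : ℕ => (algebraMap K (v.adicCompletion K) (y : K)) ^ n) atTop
        (𝓝 0) := by
      refine tendsto_def.2 fun U hU => ?_
      have hy' : Valued.v (algebraMap K (v.adicCompletion K) (y : K)) < 1 := by
        rw [v.valued_algebraMap]
        exact (v.valuation_lt_one_iff_mem y).2 hy
      obtain ⟨n, hn⟩ := v.tendsto_pow_zero_of_valued_lt_one hy' hU
      filter_upwards [eventually_ge_atTop n] with m hm
      simpa using hn m hm 1 (by simp)
    have h2 := (hg.tendsto 0).comp h1
    simp only [map_zero, Function.comp_def, map_pow] at h2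
    exact tendsto_pow_atTop_nhds_zero_iff_norm_lt_one.1 h2
  refine ⟨hlt, fun h => ?_⟩
  by_contra hx
  -- An inverse of `x` modulo `v` gives `1 = z + y * x` with both terms of norm below 1, against the
  -- ultrametric inequality.
  obtain ⟨y, z, hz, hyz⟩ := v.isMaximal.exists_inv hx
  have h1 : g (algebraMap K _ (z : K)) =
      1 - g (algebraMap K _ (y : K)) * g (algebraMap K _ (x : K)) := by
    rw [← map_mul, ← map_mul, ← map_mul, eq_sub_iff_add_eq, ← map_add, ← map_add, ← map_add,
      add_comm, hyz]
    simp
  have h2 : ‖g (algebraMap K _ (y : K)) * g (algebraMap K _ (x : K))‖ < 1 := by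
    rw [norm_mul]
    exact mul_lt_one_of_nonneg_of_lt_one_right (hle y) (norm_nonneg _) h
  have h3 : (1 : E) = g (algebraMap K _ (z : K)) +
      g (algebraMap K _ (y : K)) * g (algebraMap K _ (x : K)) := by rw [h1]; ring
  have h4 : ‖(1 : E)‖ ≤ max ‖g (algebraMap K _ (z : K))‖
      ‖g (algebraMap K _ (y : K)) * g (algebraMap K _ (x : K))‖ := by
    conv_lhs => rw [h3]
    exact isNonarchimedean_spectralNorm (K := ℚ_[p]) (L := E) _ _
  rw [norm_one] at h4
  exact absurd h4 (not_le.2 (max_lt (hlt hz) h2))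

/-- An embedding of a number field in a normed extension of `ℚ_[p]` which induces the prime `w`
extends to the completion at `w`. -/
theorem exists_continuous_extension (w : HeightOneSpectrum (𝓞 K))
    {E : Type*} [NormedField E] [NormedAlgebra ℚ_[p] E] [FiniteDimensional ℚ_[p] E]
    (σ : K →+* E) (hσ : ∀ x : 𝓞 K, x ∈ w.asIdeal ↔ ‖σ (x : K)‖ < 1) :
    ∃ g : w.adicCompletion K →+* E, Continuous g ∧ ∀ x, g (algebraMap K _ x) = σ x := by
  have hle (y : 𝓞 K) : ‖σ (y : K)‖ ≤ 1 := by
    rw [NormedAlgebra.norm_eq_spectralNorm ℚ_[p]]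
    exact spectralNorm_ringOfIntegers_le_one (σ.comp (algebraMap (𝓞 K) K)) y
  have : CompleteSpace E := FiniteDimensional.complete ℚ_[p] E
  let τ : WithVal (w.valuation K) →+* E := σ.comp (WithVal.equiv (w.valuation K)).toRingHom
  have hτ : Continuous τ := by
    refine WithVal.continuous_of_bounded _ τ p ?_ {x | ‖x‖ ≤ 1} ?_ ?_
    · exact_mod_cast (Fact.out : p.Prime).ne_zero
    · intro U hU
      obtain ⟨ε, hε, hU⟩ := Metric.mem_nhds_iff.1 hU
      have hp : ‖(p : E)‖ < 1 := by
        have := norm_algebraMap' E (p : ℚ_[p])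
        rw [map_natCast] at this
        rw [this]
        exact Padic.norm_p_lt_one
      obtain ⟨n, hn⟩ := exists_pow_lt_of_lt_one hε hp
      refine ⟨n, fun s hs => hU ?_⟩
      rw [mem_ball_zero_iff, map_natCast, norm_mul, norm_pow]
      exact (mul_le_of_le_one_right (by positivity) hs).trans_lt hn
    · intro x hx
      -- A `w`-integral element is a fraction `a / b` with `b` outside `w`, and then `σ b` has norm
      -- exactly 1.
      obtain ⟨a, b, hab⟩ := exists_primeCompl_mul_eq_of_integer w x.ofVal hx
      have hb : ‖σ ((b : 𝓞 K) : K)‖ = 1 :=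
        le_antisymm (hle _) (not_lt.1 fun h => b.2 ((hσ _).2 h))
      have h := congrArg (fun y => ‖σ y‖) hab
      simp only [map_mul, norm_mul, hb, mul_one] at h
      exact h.trans_le (hle a)
  refine ⟨(UniformSpace.Completion.extensionHom τ hτ).comp
    (adicCompletion.equiv K w).toRingHom, ?_, ?_⟩
  · exact UniformSpace.Completion.continuous_extension.comp
      (adicCompletion.continuous_toCompletion K w)
  · intro x
    exact UniformSpace.Completion.extensionHom_coe τ hτ (WithVal.toVal _ x)

end IsDedekindDomain.HeightOneSpectrum

/-! ### Local Galois groups versus local degrees. -/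

section LocalDegree

variable {K M : Type*} [Field K] [NumberField K] [Field M] [NumberField M] [Algebra K M]
  {p : ℕ} [Fact p.Prime] {v : HeightOneSpectrum (𝓞 K)}

/-- The prime induced on a number field by an embedding into a finite extension of `ℚ_[p]`. -/
theorem exists_prime_of_padic_embedding {E : Type*} [Field E] [Algebra ℚ_[p] E]
    [FiniteDimensional ℚ_[p] E] (σ : M →+* E) :
    ∃ w : HeightOneSpectrum (𝓞 M),
      ∀ x : 𝓞 M, x ∈ w.asIdeal ↔ spectralNorm ℚ_[p] E (σ (x : M)) < 1 := by
  let := spectralNorm.normedField ℚ_[p] E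
  let := spectralNorm.normedAlgebra ℚ_[p] E
  have hle (y : 𝓞 M) : ‖σ (y : M)‖ ≤ 1 :=
    spectralNorm_ringOfIntegers_le_one (σ.comp (algebraMap (𝓞 M) M)) y
  have hna (a b : E) : ‖a + b‖ ≤ max ‖a‖ ‖b‖ :=
    isNonarchimedean_spectralNorm (K := ℚ_[p]) (L := E) a b
  let I : Ideal (𝓞 M) :=
    { carrier := {x | ‖σ (x : M)‖ < 1}
      zero_mem' := by simp
      add_mem' := fun {a b} ha hb => by
        simp only [Set.mem_ofPred_eq, map_add] at *
        exact (hna _ _).trans_lt (max_lt ha hb)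
      smul_mem' := fun c x hx => by
        simp only [Set.mem_ofPred_eq, smul_eq_mul, map_mul, norm_mul] at *
        exact mul_lt_one_of_nonneg_of_lt_one_right (hle c) (norm_nonneg _) hx }
  have hI (x : 𝓞 M) : x ∈ I ↔ ‖σ (x : M)‖ < 1 := Iff.rfl
  have hprime : I.IsPrime := by
    refine Ideal.isPrime_iff.2 ⟨?_, fun {x y} hxy => ?_⟩
    · rw [Ideal.ne_top_iff_one, hI]
      simp
    · by_contra! h
      simp only [hI, not_lt] at h
      simp only [hI, map_mul, norm_mul] at hxy
      exact absurd hxy (not_lt.2 (one_le_mul_of_one_le_of_one_le h.1 h.2))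
  have hbot : I ≠ ⊥ := by
    have hp : (p : 𝓞 M) ∈ I := by
      rw [hI]
      have := norm_algebraMap' E (p : ℚ_[p])
      rw [map_natCast] at this
      simpa [this] using Padic.norm_p_lt_one (p := p)
    intro h
    rw [h, Ideal.mem_bot] at hp
    exact (Fact.out : p.Prime).ne_zero (by exact_mod_cast hp)
  exact ⟨⟨I, hprime, hbot⟩, hI⟩

/-- The order of the local Galois group at `v` bounds the local degree from below. -/
theorem HasLocalGroup.card_le_of_localDegreeLE (hv : (p : 𝓞 K) ∈ v.asIdeal) {C : Type*} [Group C]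
    (hC : HasLocalGroup (K := K) (L := M) v C) {B : ℕ}
    (hB : LocalDegreeLE (K := K) (L := M) p v B) : Nat.card C ≤ B := by
  obtain ⟨E, _, _, σ, hfin, hdeg, hσ⟩ := hB
  obtain ⟨F, hF, hgal, ⟨e⟩, hcompl⟩ := hC
  obtain ⟨w, hw⟩ := exists_prime_of_padic_embedding (p := p) σ
  have hover : w.asIdeal.LiesOver v.asIdeal := by
    refine ⟨Ideal.ext fun x => ?_⟩
    rw [hσ, Ideal.mem_comap, hw]
    rfl
  obtain ⟨φ, hι, -⟩ := hcompl w hover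
  let := spectralNorm.normedField ℚ_[p] E
  let := spectralNorm.normedAlgebra ℚ_[p] E
  obtain ⟨g, hg, -⟩ := w.exists_continuous_extension (p := p) σ hw
  obtain ⟨f, hf⟩ := v.exists_continuous_padic_hom (p := p) hv
  let ψ : v.adicCompletion K →+* E :=
    g.comp (φ.toRingHom.comp (algebraMap (v.adicCompletion K) F))
  have hψ : Continuous ψ := hg.comp hι
  let : Algebra ℚ_[p] (v.adicCompletion K) := f.toAlgebra
  let : Algebra (v.adicCompletion K) E := ψ.toAlgebra
  -- The two maps `ℚ_p → E` are continuous and agree on the dense subset `ℚ`.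
  have : IsScalarTower ℚ_[p] (v.adicCompletion K) E := by
    refine .of_algebraMap_eq fun x => ?_
    refine congrFun ((Padic.denseRange_ratCast p).equalizer (continuous_algebraMap ℚ_[p] E)
      (hψ.comp hf) ?_) x
    ext q
    simp
  have : Module.Finite (v.adicCompletion K) E := .of_restrictScalars_finite ℚ_[p] _ _
  -- This injection gives `[F : K_v] ≤ [E : K_v] ≤ [E : ℚ_p]`.
  let l : F →ₗ[v.adicCompletion K] E :=
    { toFun := fun x => g (φ x)
      map_add' := by simp
      map_smul' := fun c x => by
        rw [Algebra.smul_def, Algebra.smul_def, map_mul, map_mul]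
        rfl }
  have h1 : Module.finrank (v.adicCompletion K) F ≤ Module.finrank (v.adicCompletion K) E :=
    LinearMap.finrank_le_finrank_of_injective (f := l) (g.injective.comp φ.injective)
  have : Module.Finite ℚ_[p] (v.adicCompletion K) := (v.finite_of_continuous_algebraMap hf).1
  have h2 := Module.finrank_mul_finrank ℚ_[p] (v.adicCompletion K) E
  have h3 : 0 < Module.finrank ℚ_[p] (v.adicCompletion K) := Module.finrank_pos
  rw [← Nat.card_congr e.toEquiv, IsGalois.card_aut_eq_finrank]
  exact (h1.trans ((Nat.le_mul_of_pos_left _ h3).trans h2.le)).trans hdeg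

theorem LocalDegreeLE.of_algHom {L L' : Type*} [Field L] [Algebra K L] [Field L'] [Algebra K L']
    (j : L' →ₐ[K] L) {B : ℕ} (h : LocalDegreeLE (K := K) (L := L) p v B) :
    LocalDegreeLE (K := K) (L := L') p v B := by
  obtain ⟨E, hE, hA, σ, hfin, hdeg, hσ⟩ := h
  refine ⟨E, hE, hA, σ.comp j.toRingHom, hfin, hdeg, fun x => ?_⟩
  rw [hσ x]
  simp

/-- If the local Galois group at `v` is trivial, then `M` embeds in the completion at `v`. -/
theorem HasLocalGroup.exists_algHom {C : Type*} [Group C] [Subsingleton C]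
    (hC : HasLocalGroup (K := K) (L := M) v C) : Nonempty (M →ₐ[K] v.adicCompletion K) := by
  obtain ⟨F, hF, hgal, ⟨e⟩, hcompl⟩ := hC
  obtain ⟨w, hw⟩ : ∃ w : HeightOneSpectrum (𝓞 M), w.asIdeal.LiesOver v.asIdeal := by
    have := v.isMaximal
    obtain ⟨P, hP, hPv⟩ := Ideal.exists_maximal_ideal_liesOver_of_isIntegral (S := 𝓞 M) v.asIdeal
    exact ⟨⟨P, hP.isPrime, Ideal.ne_bot_of_liesOver_of_ne_bot v.ne_bot P⟩, hPv⟩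
  obtain ⟨φ, -, hφ⟩ := hcompl w hw
  have hcard : Module.finrank (v.adicCompletion K) F = 1 := by
    rw [← IsGalois.card_aut_eq_finrank, Nat.card_congr e.toEquiv, Nat.card_unique]
  have hbij : Function.Bijective (algebraMap (v.adicCompletion K) F) := by
    rw [IntermediateField.finrank_eq_one_iff] at hcard
    subst hcard
    exact (IntermediateField.botEquiv (v.adicCompletion K) _).symm.bijective
  let θ : v.adicCompletion K ≃+* F := RingEquiv.ofBijective _ hbij
  refine ⟨{ toRingHom := θ.symm.toRingHom.comp (φ.symm.toRingHom.comp (algebraMap M _)),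
            commutes' := fun x => ?_ }⟩
  have := hφ x
  change θ.symm (φ.symm (algebraMap M _ (algebraMap K M x))) = _
  rw [← this, RingEquiv.symm_apply_eq]
  exact φ.symm_apply_apply _

end LocalDegree

/-! ### Galois group of a linearly disjoint compositum. -/

section Compositum

variable {K Ω : Type*} [Field K] [Field Ω] [Algebra K Ω]

/-- Automorphisms of two linearly disjoint finite Galois extensions have a common extension. -/
theorem IntermediateField.LinearDisjoint.exists_restrictNormalHom_eq [IsGalois K Ω]
    {A B : IntermediateField K Ω} [FiniteDimensional K A] [FiniteDimensional K B]
    [IsGalois K A] [IsGalois K B] (h : A.LinearDisjoint B) (σ : Gal(A/K)) (τ : Gal(Ω/K)) :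
    ∃ γ : Gal(Ω/K), AlgEquiv.restrictNormalHom A γ = σ ∧
      AlgEquiv.restrictNormalHom B γ = AlgEquiv.restrictNormalHom B τ := by
  let r : Gal(Ω/K) →* Gal(A/K) × Gal(B/K) :=
    (AlgEquiv.restrictNormalHom A).prod (AlgEquiv.restrictNormalHom B)
  -- The image of `r` thus has order `[A ⊔ B : K] = [A : K] [B : K]`, which makes `r` surjective.
  have hker : r.ker = (AlgEquiv.restrictNormalHom (F := K) (K₁ := Ω) (A ⊔ B : IntermediateField K Ω)).ker := by
    rw [IntermediateField.restrictNormalHom_ker, IntermediateField.fixingSubgroup_sup,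
      MonoidHom.ker_prod, IntermediateField.restrictNormalHom_ker,
      IntermediateField.restrictNormalHom_ker]
  have hcard : Nat.card r.range = Nat.card (Gal(A/K) × Gal(B/K)) := by
    rw [← Nat.card_congr (QuotientGroup.quotientKerEquivRange r).toEquiv, hker,
      Nat.card_congr (QuotientGroup.quotientKerEquivOfSurjective _
        (AlgEquiv.restrictNormalHom_surjective (F := K) (K₁ := (A ⊔ B : IntermediateField K Ω)) Ω)).toEquiv,
      Nat.card_prod, IsGalois.card_aut_eq_finrank, IsGalois.card_aut_eq_finrank,
      IsGalois.card_aut_eq_finrank, h.finrank_sup]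
  have htop : r.range = ⊤ := Subgroup.eq_top_of_card_eq _ hcard
  obtain ⟨γ, hγ⟩ := MonoidHom.range_eq_top.1 htop (σ, AlgEquiv.restrictNormalHom B τ)
  exact ⟨γ, congrArg Prod.fst hγ, congrArg Prod.snd hγ⟩

variable (L : ℕ → IntermediateField K Ω)

theorem IntermediateField.exists_restrictNormalHom_eq_of_linearDisjoint [IsGalois K Ω]
    [∀ m, FiniteDimensional K (L m)] [∀ m, IsGalois K (L m)]
    (hL : ∀ m, (L m).LinearDisjoint (⨆ j : Fin m, L j : IntermediateField K Ω))
    (σ : ∀ m, Gal(L m/K)) (n : ℕ) :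
    ∃ γ : Gal(Ω/K), ∀ j < n, AlgEquiv.restrictNormalHom (L j) γ = σ j := by
  induction n with
  | zero => exact ⟨1, by simp⟩
  | succ n ih =>
    obtain ⟨τ, hτ⟩ := ih
    have : FiniteDimensional K (⨆ j : Fin n, L j : IntermediateField K Ω) :=
      IntermediateField.finiteDimensional_iSup_of_finite
    have : IsGalois K (⨆ j : Fin n, L j : IntermediateField K Ω) := {}
    obtain ⟨γ, h1, h2⟩ := (hL n).exists_restrictNormalHom_eq (σ n) τ
    refine ⟨γ, fun j hj => ?_⟩
    rcases Nat.lt_succ_iff_lt_or_eq.1 hj with hj | rfl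
    · rw [← hτ j hj]
      ext x
      have hx : (x : Ω) ∈ (⨆ j : Fin n, L j : IntermediateField K Ω) :=
        le_iSup (fun j : Fin n => L j) ⟨j, hj⟩ x.2
      have h3 := congrArg (fun f => ((f ⟨x, hx⟩ : (⨆ j : Fin n, L j : IntermediateField K Ω)) : Ω)) h2
      simp only [AlgEquiv.restrictNormalHom_apply] at h3 ⊢
      exact h3
    · exact h1

/-- The Galois group of the compositum of a sequence of linearly disjoint finite Galois extensions
is the product of their Galois groups. -/
theorem IntermediateField.nonempty_galEquiv_pi_of_linearDisjoint [IsGalois K Ω]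
    [∀ m, FiniteDimensional K (L m)] [∀ m, IsGalois K (L m)]
    (hL : ∀ m, (L m).LinearDisjoint (⨆ j : Fin m, L j : IntermediateField K Ω)) :
    Nonempty (Gal((⨆ m, L m : IntermediateField K Ω)/K) ≃ₜ* ((m : ℕ) → Gal(L m/K))) := by
  have hGal : IsGalois K (⨆ m, L m : IntermediateField K Ω) := {}
  set N : IntermediateField K Ω := ⨆ m, L m
  let res : Gal(Ω/K) →* Gal(N/K) := AlgEquiv.restrictNormalHom N
  have hres : Function.Surjective res := AlgEquiv.restrictNormalHom_surjective Ω
  have hresc : Continuous res := InfiniteGalois.restrictNormalHom_continuous N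
  let ρ : Gal(Ω/K) →* ((m : ℕ) → Gal(L m/K)) :=
    MonoidHom.pi fun m => AlgEquiv.restrictNormalHom (L m)
  have hρc : Continuous ρ :=
    continuous_pi fun m => InfiniteGalois.restrictNormalHom_continuous (L m)
  have hρ : Function.Surjective ρ := by
    -- The range is compact, so density suffices; a basic open set constrains only finitely many
    -- coordinates.
    rw [← Set.range_eq_univ, ← (isCompact_range hρc).isClosed.closure_eq]
    refine (dense_iff_inter_open.2 ?_).closure_eq
    rintro U hU ⟨σ, hσ⟩
    obtain ⟨I, u, hu, hsub⟩ := isOpen_pi_iff.1 hU σ hσ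
    obtain ⟨γ, hγ⟩ :=
      IntermediateField.exists_restrictNormalHom_eq_of_linearDisjoint L hL σ (I.sup id + 1)
    refine ⟨ρ γ, hsub fun m hm => ?_, γ, rfl⟩
    have : ρ γ m = σ m := hγ m (Nat.lt_succ_of_le (Finset.le_sup (f := id) hm))
    rw [this]
    exact (hu m hm).2
  have hker : res.ker = ρ.ker := by
    ext γ
    -- Through the Galois connection, fixing `N` becomes a containment of `N` in the fixed field of
    -- `zpowers γ`, which can be tested on each `L m`.
    have h1 : γ ∈ res.ker ↔ Subgroup.zpowers γ ≤ N.fixingSubgroup := by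
      rw [IntermediateField.restrictNormalHom_ker, Subgroup.zpowers_le]
    have h2 : γ ∈ ρ.ker ↔ ∀ m, Subgroup.zpowers γ ≤ (L m).fixingSubgroup := by
      simp only [Subgroup.zpowers_le, ← IntermediateField.restrictNormalHom_ker]
      exact funext_iff
    simp only [h1, h2, ← IntermediateField.le_iff_le, N, iSup_le_iff]
  let e : Gal(N/K) ≃* ((m : ℕ) → Gal(L m/K)) :=
    (QuotientGroup.quotientKerEquivOfSurjective res hres).symm.trans
      ((QuotientGroup.quotientMulEquivOfEq hker).trans
        (QuotientGroup.quotientKerEquivOfSurjective ρ hρ))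
  have he (γ : Gal(Ω/K)) : e (res γ) = ρ γ := by
    have : (QuotientGroup.quotientKerEquivOfSurjective res hres).symm (res γ) =
        (γ : Gal(Ω/K) ⧸ res.ker) := by
      rw [MulEquiv.symm_apply_eq]
      rfl
    simp only [e, MulEquiv.trans_apply, this]
    rfl
  have hec : Continuous e := by
    refine (hresc.isClosedMap.isQuotientMap hresc hres).continuous_iff.2 ?_
    exact hρc.congr fun γ => (he γ).symm
  exact ⟨{ e with
    continuous_toFun := hec
    continuous_invFun := (hec.homeoOfEquivCompactToT2 (f := e.toEquiv)).symm.continuous }⟩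

end Compositum

/-! ### Upper bound for the local degrees of a compositum. -/

section BoundedDegree

open IntermediateField in
/-- Adjoining the image of an extension `M / K` to an extension of `F` which contains the image of
`K` multiplies the degree by at most `[M : K]`. -/
theorem IntermediateField.exists_finrank_le_mul {F Ω K M : Type*} [Field F] [Field Ω] [Algebra F Ω]
    [Field K] [Field M] [Algebra K M] [FiniteDimensional K M] [Algebra.IsSeparable K M]
    (τ : M →+* Ω) (E : IntermediateField F Ω) [FiniteDimensional F E]
    (hE : ∀ x : K, τ (algebraMap K M x) ∈ E) :
    ∃ E' : IntermediateField F Ω, FiniteDimensional F E' ∧ E ≤ E' ∧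
      Module.finrank F E' ≤ Module.finrank F E * Module.finrank K M ∧ ∀ x, τ x ∈ E' := by
  obtain ⟨α, hα⟩ := Field.exists_primitive_element K M
  let κ : K →+* E := (τ.comp (algebraMap K M)).codRestrict E hE
  have hint : IsIntegral K α := IsIntegral.of_finite K α
  have hroot : Polynomial.aeval (τ α) ((minpoly K α).map κ) = 0 := by
    rw [Polynomial.aeval_def, Polynomial.eval₂_map]
    have : (algebraMap E Ω).comp κ = τ.comp (algebraMap K M) := rfl
    rw [this, ← Polynomial.hom_eval₂, ← Polynomial.aeval_def, minpoly.aeval, map_zero]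
  have hmonic : ((minpoly K α).map κ).Monic := (minpoly.monic hint).map κ
  have hint' : IsIntegral E (τ α) := ⟨_, hmonic, hroot⟩
  have hfin : FiniteDimensional E E⟮τ α⟯ := adjoin.finiteDimensional hint'
  refine ⟨E⟮τ α⟯.restrictScalars F, Module.Finite.trans (R := F) E E⟮τ α⟯, ?_, ?_, ?_⟩
  · intro x hx
    exact E⟮τ α⟯.algebraMap_mem ⟨x, hx⟩
  · change Module.finrank F E⟮τ α⟯ ≤ _
    have : Module.Free E E⟮τ α⟯ := Module.Free.of_divisionRing _ _
    rw [← Module.finrank_mul_finrank F E E⟮τ α⟯, adjoin.finrank hint',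
      ← (Field.primitive_element_iff_minpoly_natDegree_eq K α).1 hα]
    -- Over `E`, the minimal polynomial of `τ α` divides the image of that of `α` over `K`.
    refine Nat.mul_le_mul_left _ ?_
    rw [← (minpoly.monic hint).natDegree_map κ]
    exact Polynomial.natDegree_le_of_dvd (minpoly.dvd _ _ hroot) hmonic.ne_zero
  · let S : IntermediateField K M := (E⟮τ α⟯.toSubfield.comap τ).toIntermediateField fun x =>
      E⟮τ α⟯.algebraMap_mem ⟨_, hE x⟩
    have hS : K⟮α⟯ ≤ S := adjoin_simple_le_iff.2 (mem_adjoin_simple_self E (τ α))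
    intro x
    exact hS (hα ▸ mem_top : x ∈ K⟮α⟯)

/-- The image of a normal extension does not depend on the embedding. -/
theorem AlgHom.mem_range_of_normal {K M Ω : Type*} [Field K] [Field M] [Field Ω] [Algebra K M]
    [Algebra K Ω] [Normal K M] (f g : M →ₐ[K] Ω) (x : M) : ∃ y, g y = f x := by
  have hx := Normal.isIntegral (F := K) inferInstance x
  have h : f x ∈ (minpoly K x).rootSet Ω := by
    rw [Polynomial.mem_rootSet]
    exact ⟨minpoly.ne_zero hx, by rw [Polynomial.aeval_algHom_apply, minpoly.aeval, map_zero]⟩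
  rw [← (Normal.splits inferInstance x).image_rootSet g] at h
  obtain ⟨y, -, hy⟩ := h
  exact ⟨y, hy⟩

/-- Inside an algebraic closure of `ℚ_p`, start from the image of `K_v` and adjoin the images of `L
j` for `j < i` one at a time. The remaining `L m` add nothing. -/
theorem localDegreeLE_iSup {K : Type*} [Field K] [NumberField K] {p : ℕ} [Fact p.Prime]
    {v : HeightOneSpectrum (𝓞 K)} (hv : (p : 𝓞 K) ∈ v.asIdeal)
    (L : ℕ → IntermediateField K (AlgebraicClosure K)) [∀ m, FiniteDimensional K (L m)]
    [∀ m, IsGalois K (L m)] (i : ℕ)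
    (hsplit : ∀ m, i ≤ m → Nonempty (L m →ₐ[K] v.adicCompletion K)) :
    LocalDegreeLE (K := K) (L := (⨆ m, L m : IntermediateField K (AlgebraicClosure K))) p v
      (Module.finrank ℚ K * ∏ j ∈ Finset.range i, Module.finrank K (L j)) := by
  obtain ⟨f, hf⟩ := v.exists_continuous_padic_hom (p := p) hv
  let : Algebra ℚ_[p] (v.adicCompletion K) := f.toAlgebra
  obtain ⟨hfin, hdeg⟩ := v.finite_of_continuous_algebraMap (p := p) hf
  let g : v.adicCompletion K →ₐ[ℚ_[p]] AlgebraicClosure ℚ_[p] := IsAlgClosed.lift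
  let : Algebra K (AlgebraicClosure ℚ_[p]) :=
    (g.toRingHom.comp (algebraMap K (v.adicCompletion K))).toAlgebra
  let gK : v.adicCompletion K →ₐ[K] AlgebraicClosure ℚ_[p] :=
    { g.toRingHom with commutes' := fun _ => rfl }
  let τ : AlgebraicClosure K →ₐ[K] AlgebraicClosure ℚ_[p] := IsAlgClosed.lift
  have hK (x : K) : τ (algebraMap K _ x) ∈ g.fieldRange := ⟨algebraMap K _ x, (τ.commutes x).symm⟩
  have key (n : ℕ) : ∃ E : IntermediateField ℚ_[p] (AlgebraicClosure ℚ_[p]),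
      FiniteDimensional ℚ_[p] E ∧ g.fieldRange ≤ E ∧
      Module.finrank ℚ_[p] E ≤
        Module.finrank ℚ K * ∏ j ∈ Finset.range n, Module.finrank K (L j) ∧
      ∀ j < n, ∀ x ∈ L j, τ x ∈ E := by
    induction n with
    | zero =>
      let e : v.adicCompletion K ≃ₐ[ℚ_[p]] g.fieldRange := AlgEquiv.ofInjectiveField g
      refine ⟨g.fieldRange, Module.Finite.equiv e.toLinearEquiv, le_rfl, ?_, by simp⟩
      rw [← e.toLinearEquiv.finrank_eq]
      simpa using hdeg
    | succ n ih =>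
      obtain ⟨E, hE, hgE, hEdeg, hLE⟩ := ih
      obtain ⟨E', hE', hle, hdeg', hmem⟩ := IntermediateField.exists_finrank_le_mul (K := K)
        (M := L n) ((τ : AlgebraicClosure K →+* _).comp (algebraMap (L n) (AlgebraicClosure K))) E
        fun x => hgE (hK x)
      refine ⟨E', hE', hgE.trans hle, ?_, fun j hj x hx => ?_⟩
      · rw [Finset.prod_range_succ, ← mul_assoc]
        exact hdeg'.trans (Nat.mul_le_mul_right _ hEdeg)
      · rcases Nat.lt_succ_iff_lt_or_eq.1 hj with hj | rfl
        · exact hle (hLE j hj x hx)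
        · exact hmem ⟨x, hx⟩
  obtain ⟨E, hE, hgE, hEdeg, hLE⟩ := key i
  let S : IntermediateField K (AlgebraicClosure K) :=
    (E.toSubfield.comap (τ : AlgebraicClosure K →+* _)).toIntermediateField fun x => hgE (hK x)
  have hS : (⨆ m, L m) ≤ S := by
    refine iSup_le fun m x hx => ?_
    rcases lt_or_ge m i with hm | hm
    · exact hLE m hm x hx
    · obtain ⟨h⟩ := hsplit m hm
      -- `τ` need not agree on `L m` with the embedding through `K_v`, but by normality the images
      -- coincide.
      obtain ⟨y, hy⟩ := AlgHom.mem_range_of_normal (τ.comp (L m).val) (gK.comp h) ⟨x, hx⟩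
      exact hgE ⟨h y, hy⟩
  let σ : (⨆ m, L m : IntermediateField K (AlgebraicClosure K)) →+* E :=
    (τ.toRingHom.comp
      (algebraMap (⨆ m, L m : IntermediateField K (AlgebraicClosure K)) _)).codRestrict E
      fun x => hS x.2
  refine ⟨E, inferInstance, inferInstance, σ, hE, hEdeg, fun x => ?_⟩
  rw [v.mem_asIdeal_iff_spectralNorm_lt_one hf ((IntermediateField.inclusion hgE).comp
    g.rangeRestrict)]
  have : σ (algebraMap K _ (x : K)) = (IntermediateField.inclusion hgE).comp
      g.rangeRestrict (algebraMap K _ (x : K)) := Subtype.ext (τ.commutes (x : K))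
  rw [this]

end BoundedDegree

/-! ### Element orders and assembly of the theorem. -/

/-- If all orders were at most `B`, the exponent would divide `B!`. -/
theorem Monoid.exists_lt_orderOf_of_lt_exponent {G : Type*} [Group G] [Finite G] {B : ℕ}
    (h : B.factorial < Monoid.exponent G) : ∃ g : G, B < orderOf g := by
  by_contra! hB
  refine absurd (Nat.le_of_dvd B.factorial_pos (Monoid.exponent_dvd.2 fun g => ?_)) (not_le.2 h)
  exact Nat.dvd_factorial (orderOf_pos g) (hB g)

theorem isRealisation_iSup {K : Type*} [Field K] [CharZero K] (G : ℕ → Type*) [∀ m, Group (G m)]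
    [∀ m, TopologicalSpace (G m)] [∀ m, DiscreteTopology (G m)]
    (L : ℕ → IntermediateField K (AlgebraicClosure K)) [∀ m, FiniteDimensional K (L m)]
    [∀ m, IsGalois K (L m)] (e : ∀ m, Gal(L m/K) ≃* G m)
    (hL : ∀ m, (L m).LinearDisjoint (⨆ j : Fin m, L j : IntermediateField K (AlgebraicClosure K))) :
    IsRealisation ((m : ℕ) → G m) (⨆ m, L m : IntermediateField K (AlgebraicClosure K)) := by
  have : IsGalois K (AlgebraicClosure K) := IsAlgClosure.isGalois K _
  refine ⟨{}, ?_⟩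
  obtain ⟨φ⟩ := IntermediateField.nonempty_galEquiv_pi_of_linearDisjoint L hL
  have (m : ℕ) : DiscreteTopology Gal(L m/K) :=
    krullTopology_discreteTopology_of_finiteDimensional K (L m)
  let ψ : ((m : ℕ) → Gal(L m/K)) ≃ₜ* ((m : ℕ) → G m) :=
    { MulEquiv.piCongrRight e with
      continuous_toFun := continuous_pi fun m =>
        (continuous_of_discreteTopology (f := e m)).comp (continuous_apply m)
      continuous_invFun := continuous_pi fun m =>
        (continuous_of_discreteTopology (f := (e m).symm)).comp (continuous_apply m) }
  exact ⟨φ.trans ψ⟩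

theorem theorem2p1 {K : Type*} [Field K] [NumberField K]
    (p : ℕ → ℕ) [∀ i, Fact (p i).Prime]
    (v : ℕ → HeightOneSpectrum (𝓞 K))
    (hv : ∀ i, (v i).asIdeal.LiesOver (Ideal.span {(p i : ℤ)}))
    (G : ℕ → Type*) [∀ m, Group (G m)] [∀ m, Finite (G m)]
    [∀ m, TopologicalSpace (G m)] [∀ m, DiscreteTopology (G m)]
    (hexp : ∀ n : ℕ, ∃ m, n < Monoid.exponent (G m))
    (hsol : ∀ C : (m : ℕ) → (v '' Set.Iic m : Set (HeightOneSpectrum (𝓞 K))) → Subgroup (G m),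
      (∀ m u, IsCyclic (C m u)) →
      ∃ L : ℕ → IntermediateField K (AlgebraicClosure K),
        ∀ m, IsGrunwaldSolution (v '' Set.Iic m) (C m) (L m) ∧
          (L m).LinearDisjoint (⨆ j : Fin m, L j : IntermediateField K (AlgebraicClosure K))) :
    (∃ L : IntermediateField K (AlgebraicClosure K),
      IsRealisation ((m : ℕ) → G m) L ∧
      ∀ i, LocalDegreeLE (K := K) (L := L) (p i) (v i)
        (Module.finrank ℚ K * ∏ j ∈ Finset.range i, Nat.card (G j))) ∧
    (∃ L : IntermediateField K (AlgebraicClosure K),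
      IsRealisation ((m : ℕ) → G m) L ∧
      ∀ i, ∀ B : ℕ, ¬ LocalDegreeLE (K := K) (L := L) (p i) (v i) B) := by
  have hpv (i : ℕ) : (p i : 𝓞 K) ∈ (v i).asIdeal := by
    have h : (p i : ℤ) ∈ Ideal.span {(p i : ℤ)} := Ideal.mem_span_singleton_self _
    rw [(hv i).over, Ideal.mem_comap] at h
    simpa using h
  constructor
  · obtain ⟨L, hL⟩ := hsol (fun _ _ => ⊥) fun _ _ => inferInstance
    choose hL hdisj using hL
    choose hfin hgal e hloc using hL
    refine ⟨⨆ m, L m, isRealisation_iSup G L (fun m => (e m).some) hdisj, fun i => ?_⟩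
    have hcard (j : ℕ) : Nat.card (G j) = Module.finrank K (L j) := by
      rw [← Nat.card_congr (e j).some.toEquiv, IsGalois.card_aut_eq_finrank]
    simp only [hcard]
    -- Indices start at 0 and `v i` belongs to `v '' Set.Iic m` once `i ≤ m`, so exactly the `i`
    -- fields `L j` with `j < i` may fail to split.
    refine localDegreeLE_iSup (hpv i) L i fun m hm => ?_
    have : NumberField (L m) := NumberField.of_module_finite K (L m)
    exact (hloc m ⟨v i, i, hm, rfl⟩).exists_algHom
  · have hmax (m : ℕ) : ∃ g : G m, ∀ h : G m, orderOf h ≤ orderOf g :=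
      Finite.exists_max orderOf
    choose g hg using hmax
    obtain ⟨L, hL⟩ := hsol (fun m _ => Subgroup.zpowers (g m)) fun _ _ => inferInstance
    choose hL hdisj using hL
    choose hfin hgal e hloc using hL
    refine ⟨⨆ m, L m, isRealisation_iSup G L (fun m => (e m).some) hdisj, fun i B hB => ?_⟩
    obtain ⟨m, hm, hBm⟩ : ∃ m, i ≤ m ∧ B < orderOf (g m) := by
      -- Adding the orders for `j < i` forces any `m` with `orderOf (g m) > N` to satisfy `i ≤ m`,
      -- so that the local group at `v i` is prescribed.
      let N := B + ∑ j ∈ Finset.range i, orderOf (g j)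
      obtain ⟨m, hm⟩ := hexp N.factorial
      obtain ⟨h, hh⟩ := Monoid.exists_lt_orderOf_of_lt_exponent hm
      have hN : N < orderOf (g m) := hh.trans_le (hg m h)
      refine ⟨m, ?_, (Nat.le_add_right _ _).trans_lt hN⟩
      by_contra! hmi
      have := Finset.single_le_sum (f := fun j => orderOf (g j)) (fun _ _ => Nat.zero_le _)
        (Finset.mem_range.2 hmi)
      simp only [N] at hN this
      omega
    have : NumberField (L m) := NumberField.of_module_finite K (L m)
    have hle := (hloc m ⟨v i, i, hm, rfl⟩).card_le_of_localDegreeLE (hpv i)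
      (hB.of_algHom (IntermediateField.inclusion (le_iSup L m)))
    rw [Nat.card_zpowers] at hle
    exact absurd hle (not_le.2 hBm)
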